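/- Let $\{|0\rangle,|1\rangle,|2\rangle\}$ be the standard basis of $\mathbb C^3$ and, for $i,j\in\{0,1\}$, put $|\eta_i\rangle=|0\rangle+(-1)^i|1\rangle$ and $|\xi_j\rangle=|1\rangle+(-1)^j|2\rangle$. In $(\mathbb C^3)^{\otimes 3}=\mathbb C^3_A\otimes\mathbb C^3_B\otimes\mathbb C^3_C$ consider the (unnormalized) vectors $$|\psi(i,j)\rangle_1=|0\rangle|\eta_i\rangle|\xi_j\rangle,\quad |\psi(i,j)\rangle_2=|\eta_i\rangle|2\rangle|\xi_j\rangle,\quad |\psi(i,j)\rangle_3=|2\rangle|\xi_j\rangle|\eta_i\rangle,$$ $$|\psi(i,j)\rangle_4=|\eta_i\rangle|\xi_j\rangle|0\rangle,\quad |\psi(i,j)\rangle_5=|\xi_j\rangle|0\rangle|\eta_i\rangle,\quad |\psi(i,j)\rangle_6=|\xi_j\rangle|\eta_i\rangle|2\rangle,$$ and $|S\rangle=(|0\rangle+|1\rangle+|2\rangle)^{\otimes 3}$. Let $\mathcal U^S_{BB}$ be the set of the 22 vectors $|\psi(i,j)\rangle_l$ with $1\le l\le 6$ and $(i,j)\ne(0,0)$,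 $|S\rangle$, and $|\psi(0,0)\rangle_l-|\psi(0,0)\rangle_{l+1}$ for $l=1,3,5$. Let $\mathcal{GE}(5)$ be the orthogonal complement of the span of $\mathcal U^S_{BB}$. **Theorem.** The subspace $\mathcal{GE}(5)$ has dimension $5$ and is genuinely entangled, that is, no density matrix supported on it is a convex mixture of pure states each of which is a product across some bipartite cut (possibly different cuts). Moreover $\mathcal{GE}(5)$ is distillable across every bipartite cut, in the following sense: for each of the cuts $A|BC$, $B|AC$, $C|AB$, every density matrix $\rho$ supported on $\mathcal{GE}(5)$ (that is, whose range lies in $\mathcal{GE}(5)$) is 1-distillable across that cut. Here $\rho$ is called 1-distillable across a cut $\alpha|\beta$ if there is a vector $|\psi\rangle$ of Schmidt rank $2$ with respect to $\alpha|\beta$ such that $\langle\psi|\rho^{T_\alpha}|\psi\rangle<0$, where $T_\alpha$ is the partial transpose on $\alpha$. -/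

import Mathlib

open scoped Matrix ComplexOrder

namespace GenEnt

noncomputable section

/-! Bipartite systems with coordinate index sets `α` and `β`. -/

/-- Schmidt rank of a bipartite vector: the rank of its coefficient matrix. -/
def schmidtRank {α β : Type*} [Fintype β] (ψ : α × β → ℂ) : ℕ :=
  (Matrix.of fun a b => ψ (a, b)).rank

/-- Partial transpose with respect to the first party. -/
def partialTranspose {α β : Type*} (ρ : Matrix (α × β) (α × β) ℂ) :
    Matrix (α × β) (α × β) ℂ :=
  Matrix.of fun x y => ρ (y.1, x.2) (x.1, y.2)

/-- `ρ` is 1-distillable: some vector `ψ` of Schmidt rank two satisfies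
`⟨ψ| ρ^Γ |ψ⟩ < 0`. (For Hermitian `ρ` the expectation value is real.) -/
def OneDistillable {α β : Type*} [Fintype α] [Fintype β]
    (ρ : Matrix (α × β) (α × β) ℂ) : Prop :=
  ∃ ψ : α × β → ℂ, schmidtRank ψ = 2 ∧ (star ψ ⬝ᵥ (partialTranspose ρ *ᵥ ψ)).re < 0

/-- `ρ` is a density matrix. -/
def IsDensity {ι : Type*} [Fintype ι] (ρ : Matrix ι ι ℂ) : Prop :=
  ρ.PosSemidef ∧ ρ.trace = 1

/-! Three qutrits. -/

/-- Labels `(p, q, r)` of the computational basis vectors `|p⟩_A |q⟩_B |r⟩_C`. -/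
abbrev Idx : Type := Fin 3 × Fin 3 × Fin 3

/-- The Hilbert space of three qutrits. -/
abbrev Qutrits : Type := EuclideanSpace ℂ Idx

/-- The three bipartite cuts `A|BC`, `B|AC`, `C|AB`. -/
inductive Cut : Type
  | A_BC
  | B_AC
  | C_AB

/-- Regrouping of the coordinates of three qutrits according to a cut. -/
def Cut.equiv : Cut → Idx ≃ Fin 3 × (Fin 3 × Fin 3)
  | .A_BC => Equiv.refl _
  | .B_AC =>
    { toFun := fun x => (x.2.1, (x.1, x.2.2))
      invFun := fun y => (y.2.1, (y.1, y.2.2))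
      left_inv := fun _ => rfl
      right_inv := fun _ => rfl }
  | .C_AB =>
    { toFun := fun x => (x.2.2, (x.1, x.2.1))
      invFun := fun y => (y.2.1, (y.2.2, y.1))
      left_inv := fun _ => rfl
      right_inv := fun _ => rfl }

/-- `ρ` is 1-distillable across the cut `c`. -/
def OneDistillableAcross (c : Cut) (ρ : Matrix Idx Idx ℂ) : Prop :=
  OneDistillable (Matrix.reindex c.equiv c.equiv ρ)

/-- A pure state vector is biseparable if it is a product vector across some cut. -/
def BiseparableVector (ψ : Idx → ℂ) : Prop :=
  ∃ c : Cut, schmidtRank (ψ ∘ c.equiv.symm) = 1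

/-- Biseparable density matrices: convex mixtures of normalized biseparable pure states
(possibly biseparable across different cuts). -/
def Biseparable (ρ : Matrix Idx Idx ℂ) : Prop :=
  ρ ∈ convexHull ℝ {σ : Matrix Idx Idx ℂ | ∃ ψ : Idx → ℂ,
    BiseparableVector ψ ∧ star ψ ⬝ᵥ ψ = 1 ∧ σ = Matrix.vecMulVec ψ (star ψ)}

/-- `ρ` is supported on the subspace `V`. -/
def SupportedOn (ρ : Matrix Idx Idx ℂ) (V : Submodule ℂ Qutrits) : Prop :=
  LinearMap.range (Matrix.toEuclideanLin ρ) ≤ V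

/-- A genuinely entangled subspace: no density matrix supported on it is biseparable. -/
def IsGenuinelyEntangled (V : Submodule ℂ Qutrits) : Prop :=
  ∀ ρ : Matrix Idx Idx ℂ, IsDensity ρ → SupportedOn ρ V → ¬ Biseparable ρ

/-- `V` is 1-distillable across the cut `c`: every density matrix supported on it is. -/
def SubspaceOneDistillableAcross (c : Cut) (V : Submodule ℂ Qutrits) : Prop :=
  ∀ ρ : Matrix Idx Idx ℂ, IsDensity ρ → SupportedOn ρ V → OneDistillableAcross c ρ

/-! The states of the construction (not normalized). -/

/-- The computational basis vector `|k⟩` of a qutrit. -/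
def ket (k : Fin 3) : Fin 3 → ℂ := Pi.single k 1

/-- `|η_i⟩ = |0⟩ + (-1)^i |1⟩`. -/
def eta (i : Fin 2) : Fin 3 → ℂ := ket 0 + (-1 : ℂ) ^ (i : ℕ) • ket 1

/-- `|ξ_j⟩ = |1⟩ + (-1)^j |2⟩`. -/
def xi (j : Fin 2) : Fin 3 → ℂ := ket 1 + (-1 : ℂ) ^ (j : ℕ) • ket 2

/-- The product vector `|a⟩_A |b⟩_B |c⟩_C`. -/
def prodVec (a b c : Fin 3 → ℂ) : Qutrits :=
  WithLp.toLp 2 fun x => a x.1 * b x.2.1 * c x.2.2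

/-- `|ψ(i,j)⟩_1`, …, `|ψ(i,j)⟩_6`. -/
def psi1 (i j : Fin 2) : Qutrits := prodVec (ket 0) (eta i) (xi j)
def psi2 (i j : Fin 2) : Qutrits := prodVec (eta i) (ket 2) (xi j)
def psi3 (i j : Fin 2) : Qutrits := prodVec (ket 2) (xi j) (eta i)
def psi4 (i j : Fin 2) : Qutrits := prodVec (eta i) (xi j) (ket 0)
def psi5 (i j : Fin 2) : Qutrits := prodVec (xi j) (ket 0) (eta i)
def psi6 (i j : Fin 2) : Qutrits := prodVec (xi j) (eta i) (ket 2)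

/-- The stopper state `|S⟩ = (|0⟩ + |1⟩ + |2⟩)^{⊗ 3}`. -/
def stopper : Qutrits :=
  prodVec (ket 0 + ket 1 + ket 2) (ket 0 + ket 1 + ket 2) (ket 0 + ket 1 + ket 2)

/-- The symmetric unextendible product basis, consisting of 19 states. -/
def symUPB : Set Qutrits :=
  {v | ∃ i j : Fin 2, (i, j) ≠ (0, 0) ∧
    (v = psi1 i j ∨ v = psi2 i j ∨ v = psi3 i j ∨
      v = psi4 i j ∨ v = psi5 i j ∨ v = psi6 i j)} ∪ {stopper}

/-- The symmetric unextendible biseparable basis, consisting of 22 states. -/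
def symUBB : Set Qutrits :=
  symUPB ∪ {psi1 0 0 - psi2 0 0, psi3 0 0 - psi4 0 0, psi5 0 0 - psi6 0 0}

/-- The subspace `GE(5)`, the orthogonal complement of the symmetric UBB. -/
def GE5 : Submodule ℂ Qutrits := (Submodule.span ℂ symUBB)ᗮ

end

end GenEnt

namespace GenEnt

open Matrix

/-! ### Kernel vectors and the partial transpose. -/

section Distillation

variable {α β : Type*}

/-! Orthogonality to the basis means being constant on six cells of the computational basis, with
coordinate sum zero (`mem_GE5_iff`); hence dimension 6 - 1 = 5. Cyclic permutation of the parties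
preserves this description, so only `A|BC` needs work. A biseparable mixture supported on `GE5`
would put a biseparable pure state inside it, and the 2×2 minors of a product vector force a
balanced vector to vanish (`IsBalanced.eq_zero_of_minors`). For distillability, two basis vectors
`(x, i)`, `(x, j)` of one cell give a product vector `|x⟩(|i⟩ - |j⟩)` in the kernel of `ρ`. Unless
`ρ` is 1-distillable, each such vector imposes linear relations on the entries of `ρ`
(`entry_eq_of_not_oneDistillable`). Together these annihilate the diagonal
(`diag_eq_zero_of_relations`), contradicting trace one. -/

lemma rank_eq_two_of_rows [Finite α] [Fintype β] {x y : α} (hxy : x ≠ y) {u w : β → ℂ}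
    (h : LinearIndependent ℂ ![u, w]) {M : Matrix α β ℂ}
    (hx : M x = u) (hy : M y = w) (h0 : ∀ a, a ≠ x → a ≠ y → M a = 0) : M.rank = 2 := by
  have hspan : Submodule.span ℂ (Set.range M.row) = Submodule.span ℂ (Set.range ![u, w]) := by
    apply le_antisymm
    · rw [Submodule.span_le]
      rintro _ ⟨a, rfl⟩
      by_cases h1 : a = x
      · subst h1
        exact Submodule.subset_span ⟨0, hx.symm⟩
      by_cases h2 : a = y
      · subst h2
        exact Submodule.subset_span ⟨1, hy.symm⟩
      · have : M.row a = 0 := h0 a h1 h2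
        rw [this]
        exact Submodule.zero_mem _
    · rw [Submodule.span_le]
      rintro _ ⟨k, rfl⟩
      fin_cases k
      · exact Submodule.subset_span ⟨x, hx⟩
      · exact Submodule.subset_span ⟨y, hy⟩
  rw [Matrix.rank_eq_finrank_span_row, hspan, finrank_span_eq_card h]
  rfl

lemma linearIndependent_single_sub_single [DecidableEq β] {i j : β} (hij : i ≠ j) (k : β)
    {t : ℂ} (ht : t ≠ 0) :
    LinearIndependent ℂ ![(Pi.single i 1 - Pi.single j 1 : β → ℂ), Pi.single k t] := by
  rw [LinearIndependent.pair_iff]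
  intro r s h
  have hi := congrFun h i
  have hj := congrFun h j
  have hk := congrFun h k
  simp only [Pi.add_apply, Pi.smul_apply, Pi.sub_apply, Pi.single_eq_same, smul_eq_mul,
    Pi.zero_apply, Pi.single_eq_of_ne hij, Pi.single_eq_of_ne hij.symm] at hi hj hk
  have hr : r = 0 := by
    -- `k` may coincide with `i` or `j`; the coefficient is read off at whichever of the two differs
    -- from `k`.
    by_cases hik : i = k
    · subst hik
      rw [Pi.single_eq_of_ne hij.symm] at hj
      linear_combination -hj
    · rw [Pi.single_eq_of_ne hik] at hi
      linear_combination hi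
  subst hr
  simpa [ht] using hk

/-- If `ρ` is not 1-distillable and `|x⟩(|i⟩ - |j⟩)` lies in its kernel, then so does it in the
kernel of the partial transpose, up to the components along `|x⟩`. -/
lemma entry_eq_of_not_oneDistillable [Fintype α] [Fintype β] {ρ : Matrix (α × β) (α × β) ℂ} (hρ : ρ.PosSemidef)
    (hnd : ¬ OneDistillable ρ) {x y : α} (hxy : x ≠ y) {i j : β}
    (hij : ∀ z, ρ (x, i) z = ρ (x, j) z) (k : β) : ρ (y, i) (x, k) = ρ (y, j) (x, k) := by
  classical
  by_cases hne : i = j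
  · rw [hne]
  by_contra hz
  apply hnd
  have hH : ∀ a b, star (ρ a b) = ρ b a := fun a b => hρ.1.apply b a
  obtain ⟨z, hzdef⟩ : ∃ z, z = ρ (y, i) (x, k) - ρ (y, j) (x, k) := ⟨_, rfl⟩
  have hz0 : z ≠ 0 := hzdef ▸ sub_ne_zero.mpr hz
  set s : ℝ := (ρ (y, k) (y, k)).re with hs
  have hs0 : 0 ≤ s := (Complex.le_def.mp (hρ.diag_nonneg (i := (y, k)))).1
  -- With `t = -ε * star z` the expectation value is `ε|z|²(εs - 2)`, so `εs < 1` suffices; the `+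
  -- 1` covers `s = 0`.
  set ε : ℝ := 1 / (s + 1) with hε
  have hε0 : 0 < ε := by positivity
  have hεs : ε * s < 1 := by
    rw [hε, div_mul_eq_mul_div, one_mul, div_lt_one (by positivity)]
    linarith
  obtain ⟨t, ht⟩ : ∃ t, t = -(ε : ℂ) * star z := ⟨_, rfl⟩
  have ht0 : t ≠ 0 := by
    rw [ht]
    exact mul_ne_zero (neg_ne_zero.mpr (by exact_mod_cast hε0.ne')) (star_ne_zero.mpr hz0)
  refine ⟨Pi.single (x, i) 1 - Pi.single (x, j) 1 + Pi.single (y, k) t, ?_, ?_⟩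
  · refine rank_eq_two_of_rows hxy (linearIndependent_single_sub_single hne k ht0) ?_ ?_ ?_
    · ext b
      simp [Pi.single_apply, hxy]
    · ext b
      simp [Pi.single_apply, hxy.symm]
    · intro a hax hay
      ext b
      simp [Pi.single_apply, hax, hay]
  · have hstar : star (Pi.single (x, i) 1 - Pi.single (x, j) 1 + Pi.single (y, k) t : α × β → ℂ)
        = Pi.single (x, i) 1 - Pi.single (x, j) 1 + Pi.single (y, k) (star t) := by
      simp [star_add, star_sub]
    have hcalc : star (Pi.single (x, i) 1 - Pi.single (x, j) 1 + Pi.single (y, k) t : α × β → ℂ) ⬝ᵥ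
        (partialTranspose ρ *ᵥ (Pi.single (x, i) 1 - Pi.single (x, j) 1 + Pi.single (y, k) t))
        = t * z + star (t * z) + star t * t * ρ (y, k) (y, k) := by
      -- Partial transposition fixes entries whose two first indices agree, so `hij` cancels the
      -- quadratic term of `|x⟩(|i⟩ - |j⟩)`, leaving a term linear in `t` that dominates for small
      -- `t`.
      have h1 : star z = ρ (x, k) (y, i) - ρ (x, k) (y, j) := by
        rw [hzdef, star_sub, hH, hH]
      have h2 : ρ (x, i) (x, j) = ρ (x, j) (x, j) := hij _
      have h3 : ρ (x, i) (x, i) = ρ (x, j) (x, i) := hij _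
      rw [hstar, star_mul t z, h1, hzdef]
      simp only [mulVec_add, mulVec_sub, mulVec_single, add_dotProduct, sub_dotProduct,
        single_dotProduct, Pi.add_apply, Pi.sub_apply, Pi.smul_apply, partialTranspose, of_apply,
        MulOpposite.smul_eq_mul_unop, MulOpposite.unop_op, Matrix.col_apply]
      rw [h3, h2]
      ring
    rw [hcalc]
    have htz : t * z = ((-(ε * Complex.normSq z) : ℝ) : ℂ) := by
      rw [ht]
      push_cast
      rw [Complex.normSq_eq_conj_mul_self]
      simp only [starRingEnd_apply]
      ring
    have htt : star t * t = ((ε ^ 2 * Complex.normSq z : ℝ) : ℂ) := by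
      rw [ht]
      push_cast
      rw [Complex.normSq_eq_conj_mul_self]
      simp only [starRingEnd_apply, star_mul, star_neg, star_star]
      have : star (ε : ℂ) = ε := by simp
      rw [this]
      ring
    have hn : 0 < Complex.normSq z := Complex.normSq_pos.mpr hz0
    rw [htz, htt]
    simp only [Complex.add_re, Complex.re_ofReal_mul, Complex.ofReal_re, Complex.star_def,
      Complex.conj_ofReal, ← hs]
    nlinarith [mul_pos hε0 hn, mul_pos (mul_pos hε0 hn) (sub_pos.mpr hεs)]

end Distillation

/-! ### Minors of product vectors. -/

lemma minor_eq_of_schmidtRank_eq_one {α β : Type*} [Fintype α] [Fintype β] {ψ : α × β → ℂ}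
    (h : schmidtRank ψ = 1) (a a' : α) (b b' : β) :
    ψ (a, b) * ψ (a', b') = ψ (a, b') * ψ (a', b) := by
  rw [schmidtRank, Matrix.rank_eq_finrank_span_row] at h
  obtain ⟨u, -, hu⟩ := finrank_eq_one_iff'.mp h
  have key : ∀ a, ∃ c : ℂ, ∀ b, ψ (a, b) = c * (u : β → ℂ) b := by
    intro a
    obtain ⟨c, hc⟩ := hu ⟨_, Submodule.subset_span ⟨a, rfl⟩⟩
    refine ⟨c, fun b => ?_⟩
    have := congrFun (congrArg Subtype.val hc) b
    exact this.symm
  obtain ⟨c, hc⟩ := key a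
  obtain ⟨c', hc'⟩ := key a'
  rw [hc, hc, hc', hc']
  ring

/-! Coordinates on `GE(5)`. -/

/-- The partition of the computational basis on whose parts the vectors of `GE(5)` are constant:
three parts of size eight and three singletons. -/
def cell (x : Idx) : Fin 6 :=
  (![![![3, 0, 0], ![1, 0, 0], ![1, 0, 0]],
     ![![2, 2, 2], ![1, 4, 2], ![1, 0, 0]],
     ![![2, 2, 2], ![1, 1, 2], ![1, 1, 5]]] : Fin 3 → Fin 3 → Fin 3 → Fin 6) x.1 x.2.1 x.2.2

/-- A representative of each cell. -/
def cellRep : Fin 6 → Idx :=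
  ![(0, 0, 1), (0, 1, 0), (1, 0, 0), (0, 0, 0), (1, 1, 1), (2, 2, 2)]

lemma cell_cellRep (k : Fin 6) : cell (cellRep k) = k := by
  revert k; decide

/-- Vectors that are constant on cells and whose coordinates sum to zero. -/
structure IsBalanced (v : Idx → ℂ) : Prop where
  eq_of_cell_eq : ∀ {x y}, cell x = cell y → v x = v y
  sum_eq_zero : ∑ x, v x = 0

lemma IsBalanced.apply {v : Idx → ℂ} (h : IsBalanced v) (x : Idx) : v x = v (cellRep (cell x)) :=
  h.eq_of_cell_eq (cell_cellRep _).symm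

lemma sum_comp_cell (f : Fin 6 → ℂ) :
    ∑ x, f (cell x) = 8 * (f 0 + f 1 + f 2) + f 3 + f 4 + f 5 := by
  simp only [Fintype.sum_prod_type, Fin.sum_univ_three]
  change (f 3 + f 0 + f 0) + (f 1 + f 0 + f 0) + (f 1 + f 0 + f 0)
    + ((f 2 + f 2 + f 2) + (f 1 + f 4 + f 2) + (f 1 + f 0 + f 0))
    + ((f 2 + f 2 + f 2) + (f 1 + f 1 + f 2) + (f 1 + f 1 + f 5)) = _
  ring

lemma isBalanced_comp_cell {f : Fin 6 → ℂ}
    (hf : 8 * (f 0 + f 1 + f 2) + f 3 + f 4 + f 5 = 0) : IsBalanced (f ∘ cell) :=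
  ⟨fun h => congrArg f h, by rw [← hf, ← sum_comp_cell]; rfl⟩

lemma IsBalanced.weighted_sum {v : Idx → ℂ} (h : IsBalanced v) :
    8 * (v (cellRep 0) + v (cellRep 1) + v (cellRep 2)) + v (cellRep 3) + v (cellRep 4)
      + v (cellRep 5) = 0 := by
  rw [← sum_comp_cell (fun k => v (cellRep k)), ← h.sum_eq_zero]
  exact Finset.sum_congr rfl fun x _ => (h.apply x).symm

/-- The cyclic permutation of the three parties. -/
def rotate : Idx ≃ Idx where
  toFun x := (x.2.2, x.1, x.2.1)
  invFun x := (x.2.1, x.2.2, x.1)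
  left_inv _ := rfl
  right_inv _ := rfl

lemma cell_rotate (x : Idx) : cell (rotate x) = ![2, 0, 1, 3, 4, 5] (cell x) := by
  revert x; decide

lemma cell_rotate_eq {x y : Idx} (h : cell x = cell y) :
    cell (rotate x) = cell (rotate y) := by
  rw [cell_rotate, cell_rotate, h]

lemma IsBalanced.comp_rotate {v : Idx → ℂ} (h : IsBalanced v) : IsBalanced (v ∘ rotate) :=
  ⟨fun hxy => h.eq_of_cell_eq (cell_rotate_eq hxy),
    by rw [← h.sum_eq_zero]; exact Equiv.sum_comp rotate v⟩

/-! Identification of `GE(5)`. -/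

section Membership

variable (v : Qutrits)

lemma inner_prodVec (a b c : Fin 3 → ℂ) :
    inner ℂ (prodVec a b c) v =
      ∑ p, ∑ q, ∑ r, v (p, q, r) * star (a p * b q * c r) := by
  simp [prodVec, PiLp.inner_apply, Fintype.sum_prod_type]

lemma inner_psi1 (i j : Fin 2) : inner ℂ (psi1 i j) v =
    v (0, 0, 1) + (-1) ^ (j : ℕ) * v (0, 0, 2) + (-1) ^ (i : ℕ) * v (0, 1, 1)
      + (-1) ^ (i : ℕ) * (-1) ^ (j : ℕ) * v (0, 1, 2) := by
  rw [psi1, inner_prodVec]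
  simp [Fin.sum_univ_three, eta, xi, ket]
  ring

lemma inner_psi2 (i j : Fin 2) : inner ℂ (psi2 i j) v =
    v (0, 2, 1) + (-1) ^ (j : ℕ) * v (0, 2, 2) + (-1) ^ (i : ℕ) * v (1, 2, 1)
      + (-1) ^ (i : ℕ) * (-1) ^ (j : ℕ) * v (1, 2, 2) := by
  rw [psi2, inner_prodVec]
  simp [Fin.sum_univ_three, eta, xi, ket]
  ring

lemma inner_psi3 (i j : Fin 2) : inner ℂ (psi3 i j) v =
    v (2, 1, 0) + (-1) ^ (j : ℕ) * v (2, 2, 0) + (-1) ^ (i : ℕ) * v (2, 1, 1)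
      + (-1) ^ (i : ℕ) * (-1) ^ (j : ℕ) * v (2, 2, 1) := by
  rw [psi3, inner_prodVec]
  simp [Fin.sum_univ_three, eta, xi, ket]
  ring

lemma inner_psi4 (i j : Fin 2) : inner ℂ (psi4 i j) v =
    v (0, 1, 0) + (-1) ^ (j : ℕ) * v (0, 2, 0) + (-1) ^ (i : ℕ) * v (1, 1, 0)
      + (-1) ^ (i : ℕ) * (-1) ^ (j : ℕ) * v (1, 2, 0) := by
  rw [psi4, inner_prodVec]
  simp [Fin.sum_univ_three, eta, xi, ket]
  ring

lemma inner_psi5 (i j : Fin 2) : inner ℂ (psi5 i j) v =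
    v (1, 0, 0) + (-1) ^ (j : ℕ) * v (2, 0, 0) + (-1) ^ (i : ℕ) * v (1, 0, 1)
      + (-1) ^ (i : ℕ) * (-1) ^ (j : ℕ) * v (2, 0, 1) := by
  rw [psi5, inner_prodVec]
  simp [Fin.sum_univ_three, eta, xi, ket]
  ring

lemma inner_psi6 (i j : Fin 2) : inner ℂ (psi6 i j) v =
    v (1, 0, 2) + (-1) ^ (j : ℕ) * v (2, 0, 2) + (-1) ^ (i : ℕ) * v (1, 1, 2)
      + (-1) ^ (i : ℕ) * (-1) ^ (j : ℕ) * v (2, 1, 2) := by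
  rw [psi6, inner_prodVec]
  simp [Fin.sum_univ_three, eta, xi, ket]
  ring

lemma inner_stopper : inner ℂ stopper v = ∑ x, v x := by
  rw [stopper, inner_prodVec]
  simp [Fintype.sum_prod_type, Fin.sum_univ_three, ket]

lemma mem_GE5_iff_inner : v ∈ GE5 ↔ ∀ w ∈ symUBB, inner ℂ w v = 0 := by
  rw [GE5, Submodule.mem_orthogonal]
  refine ⟨fun h w hw => h w (Submodule.subset_span hw), fun h w hw => ?_⟩
  induction hw using Submodule.span_induction with
  | mem w hw => exact h w hw
  | zero => simp
  | add x y _ _ hx hy => rw [inner_add_left, hx, hy, add_zero]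
  | smul c x _ hx => rw [inner_smul_left, hx, mul_zero]

/-- The signs are the characters of `(ℤ/2)²`; a function orthogonal to the three nontrivial ones is
constant. -/
lemma eq_of_sign_sums {a b c d : ℂ}
    (h : ∀ i j : Fin 2, (i, j) ≠ (0, 0) →
      a + (-1) ^ (j : ℕ) * b + (-1) ^ (i : ℕ) * c + (-1) ^ (i : ℕ) * (-1) ^ (j : ℕ) * d = 0) :
    b = a ∧ c = a ∧ d = a := by
  have h1 := h 0 1 (by decide)
  have h2 := h 1 0 (by decide)
  have h3 := h 1 1 (by decide)
  simp at h1 h2 h3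
  refine ⟨?_, ?_, ?_⟩
  · linear_combination (-h1 - h3) / 2
  · linear_combination (-h2 - h3) / 2
  · linear_combination (-h1 - h2) / 2

lemma sign_sum_eq_zero (a : ℂ) (i j : Fin 2) (hij : (i, j) ≠ (0, 0)) :
    a + (-1) ^ (j : ℕ) * a + (-1) ^ (i : ℕ) * a + (-1) ^ (i : ℕ) * (-1) ^ (j : ℕ) * a = 0 := by
  fin_cases i <;> fin_cases j <;> simp at hij ⊢

/-- Each family `psi1`, …, `psi6` makes `v` constant on a block of four basis vectors, the three
differences glue these blocks in pairs into the cells of size eight, and the stopper gives the zero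
sum. -/
lemma mem_GE5_iff : v ∈ GE5 ↔ IsBalanced v := by
  rw [mem_GE5_iff_inner]
  constructor
  · intro h
    have hm : ∀ w, (∃ i j : Fin 2, (i, j) ≠ (0, 0) ∧
        (w = psi1 i j ∨ w = psi2 i j ∨ w = psi3 i j ∨
          w = psi4 i j ∨ w = psi5 i j ∨ w = psi6 i j)) → inner ℂ w v = 0 :=
      fun w hw => h w (Or.inl (Or.inl hw))
    obtain ⟨h11, h12, h13⟩ := eq_of_sign_sums fun i j hij =>
      (inner_psi1 v i j).symm.trans (hm _ ⟨i, j, hij, by simp⟩)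
    obtain ⟨h21, h22, h23⟩ := eq_of_sign_sums fun i j hij =>
      (inner_psi2 v i j).symm.trans (hm _ ⟨i, j, hij, by simp⟩)
    obtain ⟨h31, h32, h33⟩ := eq_of_sign_sums fun i j hij =>
      (inner_psi3 v i j).symm.trans (hm _ ⟨i, j, hij, by simp⟩)
    obtain ⟨h41, h42, h43⟩ := eq_of_sign_sums fun i j hij =>
      (inner_psi4 v i j).symm.trans (hm _ ⟨i, j, hij, by simp⟩)
    obtain ⟨h51, h52, h53⟩ := eq_of_sign_sums fun i j hij =>
      (inner_psi5 v i j).symm.trans (hm _ ⟨i, j, hij, by simp⟩)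
    obtain ⟨h61, h62, h63⟩ := eq_of_sign_sums fun i j hij =>
      (inner_psi6 v i j).symm.trans (hm _ ⟨i, j, hij, by simp⟩)
    have hS : inner ℂ stopper v = 0 := h _ (Or.inl (Or.inr rfl))
    have hA : inner ℂ (psi1 0 0 - psi2 0 0) v = 0 := h _ (by simp [symUBB])
    have hB : inner ℂ (psi3 0 0 - psi4 0 0) v = 0 := h _ (by simp [symUBB])
    have hC : inner ℂ (psi5 0 0 - psi6 0 0) v = 0 := h _ (by simp [symUBB])
    rw [inner_sub_left, inner_psi1, inner_psi2] at hA
    rw [inner_sub_left, inner_psi3, inner_psi4] at hB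
    rw [inner_sub_left, inner_psi5, inner_psi6] at hC
    rw [h11, h12, h13, h21, h22, h23] at hA
    rw [h31, h32, h33, h41, h42, h43] at hB
    rw [h51, h52, h53, h61, h62, h63] at hC
    simp only [Fin.val_zero, pow_zero, one_mul] at hA hB hC
    replace hA : v (0, 2, 1) = v (0, 0, 1) := by linear_combination -hA / 4
    replace hB : v (2, 1, 0) = v (0, 1, 0) := by linear_combination hB / 4
    replace hC : v (1, 0, 2) = v (1, 0, 0) := by linear_combination -hC / 4
    have key : ∀ x, v x = v (cellRep (cell x)) := by
      rintro ⟨p, q, r⟩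
      fin_cases p <;> fin_cases q <;> fin_cases r
      exacts [rfl, rfl, h11, rfl, h12, h13, h41, hA, h21.trans hA,
        rfl, h52, hC, h42, rfl, h62.trans hC, h43, h22.trans hA, h23.trans hA,
        h51, h53, h61.trans hC, hB, h32.trans hB, h63.trans hC, h31.trans hB, h33.trans hB, rfl]
    refine ⟨fun {x y} hxy => by rw [key x, key y, hxy], by rw [← inner_stopper, hS]⟩
  · intro hv w hw
    have hconst : ∀ x, v x = v (cellRep (cell x)) := hv.apply
    rcases hw with (⟨i, j, hij, hw⟩ | hw) | hw
    · rcases hw with rfl | rfl | rfl | rfl | rfl | rfl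
      · rw [inner_psi1, hconst (0, 0, 1), hconst (0, 0, 2), hconst (0, 1, 1), hconst (0, 1, 2)]
        exact sign_sum_eq_zero _ i j hij
      · rw [inner_psi2, hconst (0, 2, 1), hconst (0, 2, 2), hconst (1, 2, 1), hconst (1, 2, 2)]
        exact sign_sum_eq_zero _ i j hij
      · rw [inner_psi3, hconst (2, 1, 0), hconst (2, 2, 0), hconst (2, 1, 1), hconst (2, 2, 1)]
        exact sign_sum_eq_zero _ i j hij
      · rw [inner_psi4, hconst (0, 1, 0), hconst (0, 2, 0), hconst (1, 1, 0), hconst (1, 2, 0)]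
        exact sign_sum_eq_zero _ i j hij
      · rw [inner_psi5, hconst (1, 0, 0), hconst (2, 0, 0), hconst (1, 0, 1), hconst (2, 0, 1)]
        exact sign_sum_eq_zero _ i j hij
      · rw [inner_psi6, hconst (1, 0, 2), hconst (2, 0, 2), hconst (1, 1, 2), hconst (2, 1, 2)]
        exact sign_sum_eq_zero _ i j hij
    · rw [Set.mem_singleton_iff.mp hw, inner_stopper, hv.sum_eq_zero]
    · rcases hw with rfl | rfl | rfl
      · rw [inner_sub_left, inner_psi1, inner_psi2, sub_eq_zero, hconst (0, 0, 1),
          hconst (0, 0, 2), hconst (0, 1, 1), hconst (0, 1, 2), hconst (0, 2, 1),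
          hconst (0, 2, 2), hconst (1, 2, 1), hconst (1, 2, 2)]
        rfl
      · rw [inner_sub_left, inner_psi3, inner_psi4, sub_eq_zero, hconst (2, 1, 0),
          hconst (2, 2, 0), hconst (2, 1, 1), hconst (2, 2, 1), hconst (0, 1, 0),
          hconst (0, 2, 0), hconst (1, 1, 0), hconst (1, 2, 0)]
        rfl
      · rw [inner_sub_left, inner_psi5, inner_psi6, sub_eq_zero, hconst (1, 0, 0),
          hconst (2, 0, 0), hconst (1, 0, 1), hconst (2, 0, 1), hconst (1, 0, 2),
          hconst (2, 0, 2), hconst (1, 1, 2), hconst (2, 1, 2)]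
        rfl

end Membership

/-! Dimension. -/

/-- The values on all cells of the vector of `GE(5)` with prescribed values on the first five. -/
def extendCoords (f : Fin 5 → ℂ) : Fin 6 → ℂ :=
  ![f 0, f 1, f 2, f 3, f 4, -(8 * (f 0 + f 1 + f 2) + f 3 + f 4)]

lemma isBalanced_extendCoords (f : Fin 5 → ℂ) : IsBalanced (extendCoords f ∘ cell) := by
  apply isBalanced_comp_cell
  change 8 * (f 0 + f 1 + f 2) + f 3 + f 4 + -(8 * (f 0 + f 1 + f 2) + f 3 + f 4) = 0
  ring

/-- The coordinates of a vector of `GE(5)` on five of the six cells. -/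
noncomputable def coordsEquiv : GE5 ≃ₗ[ℂ] (Fin 5 → ℂ) where
  toFun v k := (v : Qutrits) (cellRep k.castSucc)
  map_add' _ _ := rfl
  map_smul' _ _ := rfl
  invFun f := ⟨WithLp.toLp 2 (extendCoords f ∘ cell), by
    rw [mem_GE5_iff]
    exact isBalanced_extendCoords f⟩
  left_inv v := by
    have hv := (mem_GE5_iff _).mp v.2
    have hs := hv.weighted_sum
    ext x
    rw [hv.apply x]
    have key : ∀ k, extendCoords (fun k => (v : Qutrits) (cellRep k.castSucc)) k
        = (v : Qutrits) (cellRep k) := by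
      intro k
      fin_cases k
      · rfl
      · rfl
      · rfl
      · rfl
      · rfl
      · change -(8 * ((v : Qutrits) (cellRep 0) + (v : Qutrits) (cellRep 1)
          + (v : Qutrits) (cellRep 2)) + (v : Qutrits) (cellRep 3) + (v : Qutrits) (cellRep 4))
          = (v : Qutrits) (cellRep 5)
        linear_combination -hs
    exact key (cell x)
  right_inv f := by
    funext k
    show extendCoords f (cell (cellRep k.castSucc)) = f k
    rw [cell_cellRep]
    fin_cases k <;> rfl

lemma finrank_GE5 : Module.finrank ℂ GE5 = 5 := by
  rw [coordsEquiv.finrank_eq, Module.finrank_fin_fun]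

/-! Genuine entanglement. -/

lemma IsBalanced.eq_zero_of_minors {v : Idx → ℂ} (hv : IsBalanced v)
    (hm : ∀ (p p' : Fin 3) (i j : Fin 3 × Fin 3), v (p, i) * v (p', j) = v (p, j) * v (p', i)) :
    v = 0 := by
  obtain ⟨g, hg⟩ : ∃ g : Fin 6 → ℂ, ∀ x, v x = g (cell x) := ⟨fun k => v (cellRep k), hv.apply⟩
  have hsum : 8 * (g 0 + g 1 + g 2) + g 3 + g 4 + g 5 = 0 := by
    rw [← sum_comp_cell, ← hv.sum_eq_zero]
    exact Finset.sum_congr rfl fun x _ => (hg x).symm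
  have hm' : ∀ (p p' : Fin 3) (i j : Fin 3 × Fin 3),
      g (cell (p, i)) * g (cell (p', j)) = g (cell (p, j)) * g (cell (p', i)) := by
    intro p p' i j
    simpa only [hg] using hm p p' i j
  have e1 : g 0 * g 0 = g 0 * g 2 := hm' 0 1 (0, 1) (2, 1)
  have e2 : g 0 * g 1 = g 1 * g 2 := hm' 0 1 (0, 1) (2, 0)
  have e3 : g 0 * g 2 = g 0 * g 1 := hm' 0 2 (1, 1) (1, 2)
  have e4 : g 1 * g 1 = g 0 * g 1 := hm' 1 2 (2, 0) (2, 1)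
  suffices h : g = 0 by
    funext x
    rw [hg, h]
    rfl
  have fin : g 0 = 0 → g 1 = 0 → g 2 = 0 → g 3 = 0 → g 4 = 0 → g 5 = 0 → g = 0 := by
    intro h0 h1 h2 h3 h4 h5
    funext k
    fin_cases k <;> assumption
  -- If `g 0 ≠ 0`, the minors make all six values equal, and the zero sum reads `27 * g 0 = 0`.
  by_cases h0 : g 0 = 0
  · have h1 : g 1 = 0 := by
      rw [h0, zero_mul] at e4
      exact mul_self_eq_zero.mp e4
    have f1 : g 3 * g 2 = g 0 * g 2 := hm' 0 1 (0, 0) (0, 1)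
    have f2 : g 2 * g 1 = g 4 * g 2 := hm' 1 2 (0, 0) (1, 1)
    have f3 : g 2 * g 5 = g 0 * g 2 := hm' 1 2 (0, 0) (2, 2)
    have f4 : g 3 * g 4 = g 0 * g 2 := hm' 0 1 (0, 0) (1, 1)
    have f5 : g 3 * g 5 = g 0 * g 2 := hm' 0 2 (0, 0) (2, 2)
    have f6 : g 4 * g 5 = g 0 * g 1 := hm' 1 2 (1, 1) (2, 2)
    rw [h0, h1] at hsum
    rw [h0, zero_mul] at f1 f3 f4 f5 f6
    rw [h1, mul_zero] at f2
    have h2 : g 2 = 0 := by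
      by_contra h2
      have h3 : g 3 = 0 := by simpa [h2] using f1
      have h4 : g 4 = 0 := by simpa [h2] using f2
      have h5 : g 5 = 0 := by simpa [h2] using f3
      apply h2
      rw [h3, h4, h5] at hsum
      linear_combination hsum / 8
    -- Only `g 3`, `g 4`, `g 5` remain: their sum and pairwise products vanish, hence so do their
    -- squares.
    rw [h2] at hsum
    have h3 : g 3 = 0 := by
      rw [← mul_self_eq_zero]
      linear_combination g 3 * hsum - f4 - f5
    have h4 : g 4 = 0 := by
      rw [← mul_self_eq_zero]
      linear_combination g 4 * hsum - f4 - f6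
    refine fin h0 h1 h2 h3 h4 ?_
    linear_combination hsum - h3 - h4
  · exfalso
    have h2 : g 2 = g 0 := (mul_left_cancel₀ h0 e1).symm
    have h1 : g 1 = g 0 := by rw [← mul_left_cancel₀ h0 e3, h2]
    have f1 : g 3 * g 2 = g 0 * g 2 := hm' 0 1 (0, 0) (0, 1)
    have f2 : g 0 * g 2 = g 0 * g 4 := hm' 0 1 (1, 1) (1, 2)
    have f3 : g 2 * g 5 = g 0 * g 2 := hm' 1 2 (0, 0) (2, 2)
    rw [h2] at f1 f2 f3
    have h3 := mul_right_cancel₀ h0 f1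
    have h4 := mul_left_cancel₀ h0 f2
    have h5 := mul_left_cancel₀ h0 f3
    apply h0
    rw [h1, h2, h3, ← h4, h5] at hsum
    linear_combination hsum / 27

lemma IsBalanced.eq_zero_of_biseparableVector {v : Idx → ℂ} (hv : IsBalanced v)
    (hb : BiseparableVector v) : v = 0 := by
  obtain ⟨c, hc⟩ := hb
  have hm := minor_eq_of_schmidtRank_eq_one hc
  cases c with
  | A_BC => exact hv.eq_zero_of_minors fun p p' i j => hm p p' i j
  | B_AC =>
    -- One rotation puts `B` first but lists the others as `C, A`, whereas the cut lists `A, C`;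
    -- hence the swap.
    have h := hv.comp_rotate.eq_zero_of_minors fun p p' i j =>
      hm p p' (i.2, i.1) (j.2, j.1)
    funext x
    simpa using congrFun h (rotate.symm x)
  | C_AB =>
    have h := hv.comp_rotate.comp_rotate.eq_zero_of_minors fun p p' i j =>
      hm p p' i j
    funext x
    simpa using congrFun h (rotate.symm (rotate.symm x))

lemma isBalanced_col {ρ : Matrix Idx Idx ℂ} (h : SupportedOn ρ GE5) (y : Idx) :
    IsBalanced fun x => ρ x y := by
  have hmem := (mem_GE5_iff _).mp (h ⟨EuclideanSpace.single y 1, rfl⟩)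
  convert hmem using 1
  funext x
  simp [Matrix.toEuclideanLin, EuclideanSpace.single]

lemma isGenuinelyEntangled_GE5 : IsGenuinelyEntangled GE5 := by
  intro ρ _ hsupp hbs
  rw [Biseparable, mem_convexHull_iff_exists_fintype] at hbs
  obtain ⟨ι, _, c, σ, hc0, hc1, hσ, hsum⟩ := hbs
  choose ψ hbi hnorm hσψ using hσ
  obtain ⟨i, -, hi⟩ : ∃ i ∈ Finset.univ, 0 < c i := by
    apply Finset.exists_lt_of_sum_lt
    simp [hc1]
  -- For `w` in the basis, `⟨w|ρ|w⟩ = 0` is a sum of nonnegative terms `c k * |⟨w|ψ k⟩|²`, so `c i >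
  -- 0` forces `ψ i` to be orthogonal to `w`.
  have hmem : WithLp.toLp 2 (ψ i) ∈ GE5 := by
    rw [mem_GE5_iff_inner]
    intro w hw
    have hzero : star w.ofLp ⬝ᵥ (ρ *ᵥ w.ofLp) = 0 := by
      have := (mem_GE5_iff_inner _).mp (hsupp ⟨w, rfl⟩) w hw
      rw [EuclideanSpace.inner_eq_star_dotProduct, dotProduct_comm] at this
      simpa [Matrix.toEuclideanLin] using this
    have hexp : ∀ k, star w.ofLp ⬝ᵥ (σ k *ᵥ w.ofLp) =
        (Complex.normSq (star w.ofLp ⬝ᵥ ψ k) : ℂ) := by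
      intro k
      rw [hσψ, Matrix.vecMulVec_mulVec, Complex.normSq_eq_conj_mul_self, starRingEnd_apply,
        ← star_dotProduct, op_smul_eq_smul, dotProduct_smul, smul_eq_mul]
    rw [← hsum] at hzero
    simp only [Matrix.sum_mulVec, dotProduct_sum, Matrix.smul_mulVec, dotProduct_smul, hexp,
      Complex.real_smul, ← Complex.ofReal_mul, ← Complex.ofReal_sum, Complex.ofReal_eq_zero]
      at hzero
    rw [Finset.sum_eq_zero_iff_of_nonneg
      fun k _ => mul_nonneg (hc0 k) (Complex.normSq_nonneg _)] at hzero
    have h := (mul_eq_zero.mp (hzero i (Finset.mem_univ i))).resolve_left hi.ne'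
    rw [EuclideanSpace.inner_eq_star_dotProduct, dotProduct_comm]
    exact Complex.normSq_eq_zero.mp h
  have h0 := ((mem_GE5_iff _).mp hmem).eq_zero_of_biseparableVector (hbi i)
  have h1 := hnorm i
  have h2 : ψ i = 0 := h0
  rw [h2] at h1
  simp at h1

/-! Distillability. -/

/-- Hermiticity makes `R` constant on products of cells, so it reduces to a 6×6 matrix `g` with
weighted column sums zero, on which the relations `hrel` are a small linear system. -/
lemma diag_eq_zero_of_relations {R : Matrix Idx Idx ℂ} (hH : R.IsHermitian)
    (hcol : ∀ y, IsBalanced fun x => R x y)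
    (hrel : ∀ (x y : Fin 3) (i j k : Fin 3 × Fin 3), x ≠ y → cell (x, i) = cell (x, j) →
      R (y, i) (x, k) = R (y, j) (x, k)) (x : Idx) : R x x = 0 := by
  obtain ⟨g, hg⟩ : ∃ g : Fin 6 → Fin 6 → ℂ, ∀ x y, R x y = g (cell x) (cell y) := by
    refine ⟨fun k l => R (cellRep k) (cellRep l), fun x y => ?_⟩
    have h1 : R x y = R (cellRep (cell x)) y := (hcol y).apply x
    have h2 : R y (cellRep (cell x)) = R (cellRep (cell y)) (cellRep (cell x)) :=
      (hcol (cellRep (cell x))).apply y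
    rw [h1, ← hH.apply, h2, hH.apply]
  have hstar : ∀ k l, g k l = 0 → g l k = 0 := by
    intro k l h
    rw [← cell_cellRep k, ← cell_cellRep l, ← hg] at h ⊢
    rw [← hH.apply, h, star_zero]
  have hsum : ∀ l, 8 * (g 0 l + g 1 l + g 2 l) + g 3 l + g 4 l + g 5 l = 0 := by
    intro l
    have h := (hcol (cellRep l)).sum_eq_zero
    simp only [hg, cell_cellRep] at h
    rw [← sum_comp_cell (fun k => g k l), h]
  have h' : ∀ (x y : Fin 3) (i j k : Fin 3 × Fin 3), x ≠ y → cell (x, i) = cell (x, j) →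
      g (cell (y, i)) (cell (x, k)) = g (cell (y, j)) (cell (x, k)) := by
    intro x y i j k hxy hij
    simpa only [hg] using hrel x y i j k hxy hij
  have a1 : g 3 0 = g 0 0 := h' 1 0 (0, 0) (0, 1) (2, 1) (by decide) (by decide)
  have a2 : g 3 1 = g 0 1 := h' 1 0 (0, 0) (0, 1) (1, 0) (by decide) (by decide)
  have a3 : g 3 2 = g 0 2 := h' 1 0 (0, 0) (0, 1) (0, 0) (by decide) (by decide)
  have a4 : g 3 4 = g 0 4 := h' 1 0 (0, 0) (0, 1) (1, 1) (by decide) (by decide)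
  have a5 : g 3 5 = g 0 5 := h' 2 0 (0, 0) (0, 1) (2, 2) (by decide) (by decide)
  have b1 : g 2 0 = g 4 0 := h' 0 1 (0, 1) (1, 1) (0, 1) (by decide) (by decide)
  have b2 : g 0 0 = g 4 0 := h' 0 1 (2, 1) (1, 1) (0, 1) (by decide) (by decide)
  have c1 : g 1 1 = g 0 1 := h' 2 0 (1, 0) (1, 1) (1, 0) (by decide) (by decide)
  have c2 : g 1 2 = g 0 2 := h' 2 0 (1, 0) (1, 1) (0, 0) (by decide) (by decide)
  have c3 : g 1 5 = g 0 5 := h' 2 0 (1, 0) (1, 1) (2, 2) (by decide) (by decide)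
  have d1 : g 1 0 = g 2 0 := h' 0 2 (1, 1) (1, 2) (0, 1) (by decide) (by decide)
  have d2 : g 2 0 = g 5 0 := h' 0 2 (0, 1) (2, 2) (0, 1) (by decide) (by decide)
  have e1 : g 1 2 = g 4 2 := h' 2 1 (1, 0) (1, 1) (0, 0) (by decide) (by decide)
  have e2 : g 1 5 = g 4 5 := h' 2 1 (1, 0) (1, 1) (2, 2) (by decide) (by decide)
  have f1 : g 1 2 = g 5 2 := h' 1 2 (2, 1) (2, 2) (0, 0) (by decide) (by decide)
  -- The relations equate all entries of column 0, whose weighted sum is then `27 * g 0 0`.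
  have h00 : g 0 0 = 0 := by
    linear_combination hsum 0 / 27 - a1 / 27 + (8 * b2 - 8 * b1 - 8 * d1 - 8 * b1 + 8 * b2 + b2
      + d2 - b1 + b2) / 27
  have h40 : g 4 0 = 0 := by rw [← b2, h00]
  have h20 : g 2 0 = 0 := by rw [b1, h40]
  have h10 : g 1 0 = 0 := by rw [d1, h20]
  have h50 : g 5 0 = 0 := by rw [← d2, h20]
  have h01 := hstar _ _ h10
  have h02 := hstar _ _ h20
  have h04 := hstar _ _ h40
  have h05 := hstar _ _ h50
  have h30 : g 3 0 = 0 := by rw [a1, h00]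
  have h03 := hstar _ _ h30
  have h31 : g 3 1 = 0 := by rw [a2, h01]
  have h32 : g 3 2 = 0 := by rw [a3, h02]
  have h34 : g 3 4 = 0 := by rw [a4, h04]
  have h35 : g 3 5 = 0 := by rw [a5, h05]
  have h13 := hstar _ _ h31
  have h23 := hstar _ _ h32
  have h43 := hstar _ _ h34
  have h53 := hstar _ _ h35
  have h11 : g 1 1 = 0 := by rw [c1, h01]
  have h12 : g 1 2 = 0 := by rw [c2, h02]
  have h15 : g 1 5 = 0 := by rw [c3, h05]
  have h21 := hstar _ _ h12
  have h51 := hstar _ _ h15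
  have h42 : g 4 2 = 0 := by rw [← e1, h12]
  have h52 : g 5 2 = 0 := by rw [← f1, h12]
  have h45 : g 4 5 = 0 := by rw [← e2, h15]
  have h24 := hstar _ _ h42
  have h25 := hstar _ _ h52
  have h54 := hstar _ _ h45
  -- In this order, each column sum used has a single entry not yet known to vanish; `g 4 1` must
  -- precede column 4.
  have h33 : g 3 3 = 0 := by
    simpa [h03, h13, h23, h43, h53] using hsum 3
  have h22 : g 2 2 = 0 := by
    simpa [h02, h12, h32, h42, h52] using hsum 2
  have h41 : g 4 1 = 0 := by
    simpa [h01, h11, h21, h31, h51] using hsum 1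
  have h14 := hstar _ _ h41
  have h44 : g 4 4 = 0 := by
    simpa [h04, h14, h24, h34, h54] using hsum 4
  have h55 : g 5 5 = 0 := by
    simpa [h05, h15, h25, h35, h45] using hsum 5
  rw [hg]
  generalize cell x = k
  fin_cases k <;> assumption

lemma subspaceOneDistillableAcross_GE5 (c : Cut) : SubspaceOneDistillableAcross c GE5 := by
  intro ρ hρ hsupp
  by_contra hnd
  have hcol := isBalanced_col hsupp
  have hrow : ∀ {x y}, cell x = cell y → ∀ z, ρ x z = ρ y z :=
    fun hxy z => (hcol z).eq_of_cell_eq hxy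
  have hH := hρ.1.isHermitian
  have hpsd : (Matrix.reindex c.equiv c.equiv ρ).PosSemidef := hρ.1.submatrix _
  have key {x y : Fin 3} (hxy : x ≠ y) {i j : Fin 3 × Fin 3} (hij) (k : Fin 3 × Fin 3) :=
    entry_eq_of_not_oneDistillable hpsd hnd hxy (i := i) (j := j) hij k
  suffices hdiag : ∀ x, ρ x x = 0 by
    have h := hρ.2
    simp [Matrix.trace, hdiag] at h
  cases c with
  | A_BC =>
    exact diag_eq_zero_of_relations hH hcol fun x y i j k hxy hij =>
      key hxy (fun z => hrow hij z) k
  | B_AC =>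
    have h := diag_eq_zero_of_relations (R := ρ.submatrix rotate rotate) (hH.submatrix _)
      (fun y => (hcol (rotate y)).comp_rotate) fun x y i j k hxy hij =>
        key hxy (i := (i.2, i.1)) (j := (j.2, j.1))
          (fun z => hrow (cell_rotate_eq hij) _) (k.2, k.1)
    intro x
    simpa using h (rotate.symm x)
  | C_AB =>
    have h := diag_eq_zero_of_relations
      (R := (ρ.submatrix rotate rotate).submatrix rotate rotate) ((hH.submatrix _).submatrix _)
      (fun y => (hcol (rotate (rotate y))).comp_rotate.comp_rotate) fun x y i j k hxy hij =>
        key hxy (i := i) (j := j)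
          (fun z => hrow (cell_rotate_eq (cell_rotate_eq hij)) _) k
    intro x
    simpa using h (rotate.symm (rotate.symm x))

end GenEnt

theorem theorem1 :
    Module.finrank ℂ GenEnt.GE5 = 5 ∧
    GenEnt.IsGenuinelyEntangled GenEnt.GE5 ∧
    ∀ c : GenEnt.Cut, GenEnt.SubspaceOneDistillableAcross c GenEnt.GE5 :=
  ⟨GenEnt.finrank_GE5, GenEnt.isGenuinelyEntangled_GE5, GenEnt.subspaceOneDistillableAcross_GE5⟩
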